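/- Let $J$ items be given, item $j$ having $Q_j \ge 2$ levels $0,\dots,Q_j-1$, and let $C \ge 1$ be the number of classes. A domain structure is a matrix $\Delta=(\delta_{jc})$ that assigns to item $j$ and class $c$ a domain identifier from a finite set of size $D$; put $J(c,d)=\{j:\delta_{jc}=d\}$. The domain latent class model (DLCM) with structure $\Delta$ has parameters $\omega=(\pi,\theta)$, where $\pi$ is a probability vector on the classes and, for every class $c$ and identifier $d$, $\theta_{cd}$ is a probability vector on the response patterns of the items $J(c,d)$. A response vector $X=(X_j)_j$ has distribution $$P(X=x\mid\omega)=\sum_{c}\pi_c\,P(X=x\mid\theta,c),\qquad P(X=x\mid\theta,c)=\prod_{d}\theta_{c,d,\,x|_{J(c,d)}}.$$ The pooled domains $\mathrm{Pooled}(\Delta)$ are the parts of the partition of the items into as many parts as possible such that, given the class, the responses to the different parts are independent for all $\theta$ and all classes. Fix $\Delta$. Suppose that there is a partition $S_0\sqcup S_1\sqcup S_2=\mathrm{Pooled}(\Delta)$ (empty $S_k$ allowed) with $$\min(\kappa_0,C)+\min(\kappa_1,C)+\min(\kappa_2,C)\ \ge\ 2C+2,\qquad \kappa_k:=\prod_{j\in\bigcup_{\mathscr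 P\in S_k}\mathscr P}Q_j .$$ Then the DLCM with domain structure $\Delta$ is generically identifiable: for all $\omega=(\pi,\theta)$ outside a set of Lebesgue measure zero in the parameter space (a product of probability simplices), every parameter $\omega'=(\pi',\theta')$ of the model with the same $\Delta$ and with $P(X=x\mid\omega')=P(X=x\mid\omega)$ for all $x$ agrees with $\omega$ up to relabeling; that is, there are a permutation $\sigma$ of the classes and, for each class $c$, a permutation $\tau_c$ of the domain identifiers such that $\delta_{j,\sigma(c)}=\tau_c(\delta_{jc})$ for all $j$ and $c$, $\pi'_{\sigma(c)}=\pi_c$ for all $c$, and $\theta'_{\sigma(c),\tau_c(d)}=\theta_{c,d}$ for all $c$ and $d$. -/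

import Mathlib

open scoped BigOperators

noncomputable section

namespace DLCM

/-! ### Lebesgue measure on a probability simplex -/

/-- The point of the probability simplex on `ι` with free coordinates `x i`, `i ≠ i₀`; the
remaining coordinate is `1 - ∑ x i`. -/
def simplexPoint {ι : Type*} [Fintype ι] [DecidableEq ι] (i₀ : ι) (x : {i // i ≠ i₀} → ℝ) :
    ι → ℝ :=
  fun i => if h : i = i₀ then 1 - ∑ k, x k else x ⟨i, h⟩

theorem measurable_simplexPoint {ι : Type*} [Fintype ι] [DecidableEq ι] (i₀ : ι) :
    Measurable (simplexPoint i₀) := by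
  refine measurable_pi_lambda _ fun i => ?_
  unfold simplexPoint
  split_ifs <;> fun_prop

/-- Lebesgue measure on the probability simplex `stdSimplex ℝ ι`, of dimension `card ι - 1`:
Lebesgue measure of the `card ι - 1` free coordinates, carried to the simplex. It does not depend
on which coordinate is left out (the changes of chart are affine of determinant `± 1`). -/
def simplexMeasure (ι : Type*) [Fintype ι] [DecidableEq ι] [Nonempty ι] :
    MeasureTheory.Measure (ι → ℝ) :=
  MeasureTheory.Measure.map (simplexPoint (Classical.arbitrary ι))
    (MeasureTheory.volume.restrict {x | (∀ i, 0 ≤ x i) ∧ ∑ i, x i ≤ 1})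

/-! ### The model

There are `J` items, `C` classes and `D` domain identifiers. Item `j` has the `Q j` levels
`Fin (Q j)`. The domain structure is the matrix `Δ`, with `Δ j c` the identifier of the domain of
item `j` in class `c`. -/

variable {J C D : ℕ}

/-- The items `J(c, d)` of domain `d` in class `c`. -/
def domainItems (Δ : Fin J → Fin C → Fin D) (c : Fin C) (d : Fin D) : Finset (Fin J) :=
  Finset.univ.filter fun j => Δ j c = d

/-- Response patterns of the items in `S`. -/
abbrev Pattern (Q : Fin J → ℕ) (S : Finset (Fin J)) : Type :=
  ∀ j : S, Fin (Q j)

/-- Arrays `θ`; `θ c d r` is the probability of the pattern `r` on the items `J(c, d)` in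
class `c`. -/
abbrev Theta (Q : Fin J → ℕ) (Δ : Fin J → Fin C → Fin D) : Type :=
  ∀ (c : Fin C) (d : Fin D), Pattern Q (domainItems Δ c d) → ℝ

/-- Every `θ c d` is a probability vector. -/
def IsTheta (Q : Fin J → ℕ) (Δ : Fin J → Fin C → Fin D) (θ : Theta Q Δ) : Prop :=
  ∀ c d, θ c d ∈ stdSimplex ℝ (Pattern Q (domainItems Δ c d))

/-- The parameters `(π, θ)` of the model with domain structure `Δ`. -/
abbrev Param (Q : Fin J → ℕ) (Δ : Fin J → Fin C → Fin D) : Type :=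
  (Fin C → ℝ) × Theta Q Δ

/-- The parameter space: `π` and every `θ c d` are probability vectors. -/
def paramSpace (Q : Fin J → ℕ) (Δ : Fin J → Fin C → Fin D) : Set (Param Q Δ) :=
  {ω | ω.1 ∈ stdSimplex ℝ (Fin C) ∧ IsTheta Q Δ ω.2}

/-- Lebesgue measure on the parameter space, a product of simplices. -/
def paramMeasure (Q : Fin J → ℕ) [∀ j, NeZero (Q j)] [NeZero C] (Δ : Fin J → Fin C → Fin D) :
    MeasureTheory.Measure (Param Q Δ) :=
  (simplexMeasure (Fin C)).prod
    (MeasureTheory.Measure.pi fun c => MeasureTheory.Measure.pi fun d =>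
      simplexMeasure (Pattern Q (domainItems Δ c d)))

/-- `P(X | θ, class c)`: given the class, distinct domains are independent. -/
def classProb (Q : Fin J → ℕ) (Δ : Fin J → Fin C → Fin D) (θ : Theta Q Δ) (c : Fin C)
    (X : ∀ j, Fin (Q j)) : ℝ :=
  ∏ d, θ c d ((domainItems Δ c d).restrict X)

/-- The probability, given class `c`, that the items of `S` show the pattern `r`. -/
def classMarginal (Q : Fin J → ℕ) (Δ : Fin J → Fin C → Fin D) (θ : Theta Q Δ) (c : Fin C)
    (S : Finset (Fin J)) (r : Pattern Q S) : ℝ :=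
  ∑ X : (∀ j, Fin (Q j)) with S.restrict X = r, classProb Q Δ θ c X

/-- `P(X | ω)`, the distribution of a response vector. -/
def prob (Q : Fin J → ℕ) (Δ : Fin J → Fin C → Fin D) (ω : Param Q Δ) (X : ∀ j, Fin (Q j)) : ℝ :=
  ∑ c, ω.1 c * classProb Q Δ ω.2 c X

/-! ### Pooled domains -/

/-- The parts of `W` are independent given the class, for all `θ` and all classes. -/
def IsCondIndepPartition (Q : Fin J → ℕ) (Δ : Fin J → Fin C → Fin D)
    (W : Finpartition (Finset.univ : Finset (Fin J))) : Prop :=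
  ∀ θ : Theta Q Δ, IsTheta Q Δ θ → ∀ (c : Fin C) (X : ∀ j, Fin (Q j)),
    classProb Q Δ θ c X = ∏ P ∈ W.parts, classMarginal Q Δ θ c P (P.restrict X)

/-- `W` is the pooled domain structure of `Δ`: a partition of the items into as many parts as
possible among those whose parts are conditionally independent for all `θ`. -/
def IsPooled (Q : Fin J → ℕ) (Δ : Fin J → Fin C → Fin D)
    (W : Finpartition (Finset.univ : Finset (Fin J))) : Prop :=
  IsCondIndepPartition Q Δ W ∧
    ∀ W' : Finpartition (Finset.univ : Finset (Fin J)),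
      IsCondIndepPartition Q Δ W' → W'.parts.card ≤ W.parts.card

/-- `κ`, the number of response patterns on the union of a set of pooled domains (equal to `1`
for the empty set). -/
def kappa (Q : Fin J → ℕ) (S : Finset (Finset (Fin J))) : ℕ :=
  ∏ j ∈ S.biUnion id, Q j

/-! ### Generic identifiability for a fixed domain structure -/

/-- `ω` and `ω'` agree up to label switching: a permutation `σ` of the classes and, in each class,
a permutation `τ c` of the domain identifiers carry `(π, θ, Δ)` to `(π', θ', Δ)`. -/
def EqUpToRelabeling (Q : Fin J → ℕ) (Δ : Fin J → Fin C → Fin D) (ω ω' : Param Q Δ) : Prop :=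
  ∃ (σ : Equiv.Perm (Fin C)) (τ : Fin C → Equiv.Perm (Fin D)),
    (∀ j c, Δ j (σ c) = τ c (Δ j c)) ∧
    (∀ c, ω'.1 (σ c) = ω.1 c) ∧
    ∀ c d (X : ∀ j, Fin (Q j)),
      ω'.2 (σ c) (τ c d) ((domainItems Δ (σ c) (τ c d)).restrict X) =
        ω.2 c d ((domainItems Δ c d).restrict X)

/-- No other parameter with domain structure `Δ` has the distribution of `ω`, up to label
switching. -/
def HasUniqueDistribution (Q : Fin J → ℕ) (Δ : Fin J → Fin C → Fin D) (ω : Param Q Δ) : Prop :=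
  ∀ ω' ∈ paramSpace Q Δ, (∀ X, prob Q Δ ω' X = prob Q Δ ω X) → EqUpToRelabeling Q Δ ω ω'

/-- The parameters without a unique distribution form a set of Lebesgue measure zero. -/
def GenericallyIdentifiable (Q : Fin J → ℕ) [∀ j, NeZero (Q j)] [NeZero C]
    (Δ : Fin J → Fin C → Fin D) : Prop :=
  paramMeasure Q Δ {ω | ω ∈ paramSpace Q Δ ∧ ¬ HasUniqueDistribution Q Δ ω} = 0

end DLCM

end

/-! Grouping the pooled domains into three blocks makes the items of different blocks independent
given the class, so the distribution is a sum over classes of three-way product tensors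
$\pi_c\,u_c\otimes v_c\otimes w_c$. Recovering the classes is then uniqueness of a tensor
decomposition.

Uniqueness comes from a generalization of Kruskal's theorem (`kruskal_unique`): it suffices that
every set $T$ of at least two classes has $\dim\langle u\rangle_T+\dim\langle v\rangle_T+\dim\langle
w\rangle_T\ge 2|T|+2$. Its core is a bound for product vectors that do not split into two
independent parts (`famDim_add_le_of_not_splits`). Applied twice, it makes the relation between two
rival decompositions split, and induction matches their terms (`sum_tensor_unique`).

The terms then agree up to a permutation $\sigma$ of the classes. Items that share a domain are
generically dependent, so domains of $c$ lie inside domains of $\sigma(c)$; counting pairs turns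
this into equality. Normalization separates the weight and the factors
(`eqUpToRelabeling_of_proportional`).

Each condition on $\omega$ is the nonvanishing of finitely many polynomials, so it holds almost
everywhere once every polynomial is nonzero at one parameter (`paramMeasure_zeroSet`). Point masses
and their mixtures provide these parameters. The rival $\omega'$ is arbitrary, hence every
genericity condition is placed on $\omega$ alone. -/

namespace DLCM

open MeasureTheory Set
open scoped ContDiff

/-! ### Zero sets of analytic functions -/

/-- A real analytic function on the line that is not identically zero is nonzero almost everywhere. -/
theorem volume_zeroSet_real {f : ℝ → ℝ} (hf : ContDiff ℝ ω f) {x₀ : ℝ} (h₀ : f x₀ ≠ 0) :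
    volume {x | f x = 0} = 0 := by
  have hcod : f ⁻¹' {0}ᶜ ∈ Filter.codiscrete ℝ :=
    (contDiff_omega_iff_analyticOnNhd.1 hf).preimage_zero_mem_codiscrete h₀
  have hsub : (f ⁻¹' {0}ᶜ)ᶜ = {x | f x = 0} := by ext; simp
  have hae := ae_restrict_le_codiscreteWithin (μ := (volume : Measure ℝ)) MeasurableSet.univ hcod
  rw [Measure.restrict_univ, mem_ae_iff, hsub] at hae
  exact hae

/-- Fubini and induction: on the line through `x₀` in the first coordinate `f` vanishes only on a
null set, and for every other `a` the slice at `a` is nonzero at `Fin.tail x₀`. -/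
theorem volume_zeroSet_fin : ∀ {n : ℕ} {f : (Fin n → ℝ) → ℝ}, ContDiff ℝ ω f →
    ∀ {x₀ : Fin n → ℝ}, f x₀ ≠ 0 → volume {x | f x = 0} = 0
  | 0, f, _, x₀, h₀ => by
    have : {x | f x = 0} = ∅ := by
      ext x
      simpa [Subsingleton.elim x x₀] using h₀
    simp [this]
  | n + 1, f, hf, x₀, h₀ => by
    have hmp := (volume_preserving_piFinSuccAbove (fun _ : Fin (n + 1) => ℝ) 0).symm
    have hms : MeasurableSet {x | f x = 0} :=
      (isClosed_eq hf.continuous continuous_const).measurableSet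
    rw [← hmp.measure_preimage hms.nullMeasurableSet]
    have hcons : ∀ p : ℝ × (Fin n → ℝ),
        (MeasurableEquiv.piFinSuccAbove (fun _ : Fin (n + 1) => ℝ) 0).symm p = Fin.cons p.1 p.2 := by
      intro p
      simp [MeasurableEquiv.piFinSuccAbove, Fin.consEquiv]
    have hcd : ContDiff ℝ ω fun p : ℝ × (Fin n → ℝ) => f (Fin.cons p.1 p.2) := by
      refine hf.comp (contDiff_pi.2 fun i => ?_)
      refine Fin.cases ?_ (fun j => ?_) i
      · simpa using contDiff_fst
      · simpa [Function.comp_def] using (contDiff_apply ℝ ℝ j).comp (contDiff_snd (E := ℝ))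
    have hset : (MeasurableEquiv.piFinSuccAbove (fun _ : Fin (n + 1) => ℝ) 0).symm ⁻¹' {x | f x = 0}
        = {p : ℝ × (Fin n → ℝ) | f (Fin.cons p.1 p.2) = 0} := by
      ext p
      rw [mem_preimage, hcons]
      rfl
    rw [hset, Measure.volume_eq_prod,
      Measure.measure_prod_null (isClosed_eq hcd.continuous continuous_const).measurableSet]
    have h1 : volume {a : ℝ | f (Fin.cons a (Fin.tail x₀)) = 0} = 0 :=
      volume_zeroSet_real (f := fun a => f (Fin.cons a (Fin.tail x₀)))
        (hcd.comp (contDiff_id.prodMk contDiff_const)) (x₀ := x₀ 0) (by simpa using h₀)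
    filter_upwards [compl_mem_ae_iff.2 h1] with a ha
    exact volume_zeroSet_fin (f := fun y => f (Fin.cons a y))
      (hcd.comp (contDiff_const.prodMk contDiff_id)) (x₀ := Fin.tail x₀) ha

/-- The zero set of a nonzero analytic function on a finite-dimensional space is null. -/
theorem addHaar_zeroSet {E : Type*} [NormedAddCommGroup E] [NormedSpace ℝ E]
    [FiniteDimensional ℝ E] [MeasurableSpace E] [BorelSpace E] (μ : Measure E)
    [μ.IsAddHaarMeasure] {f : E → ℝ} (hf : ContDiff ℝ ω f) {x₀ : E} (h₀ : f x₀ ≠ 0) :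
    μ {x | f x = 0} = 0 := by
  let L : E ≃L[ℝ] (Fin (Module.finrank ℝ E) → ℝ) :=
    ContinuousLinearEquiv.ofFinrankEq (by simp)
  have hcd : ContDiff ℝ ω (f ∘ L.symm) := hf.comp L.symm.contDiff
  have h := volume_zeroSet_fin hcd (x₀ := L x₀) (by simpa using h₀)
  have hac := Measure.absolutelyContinuous_isAddHaarMeasure (μ.map L)
    (volume : Measure (Fin (Module.finrank ℝ E) → ℝ)) h
  rw [Measure.map_apply L.continuous.measurable
    (isClosed_eq hcd.continuous continuous_const).measurableSet] at hac
  simpa [Set.preimage_ofPred_eq] using hac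

/-! ### The parameter measure -/

variable {J C D : ℕ}

/-- The region of free coordinates that parametrizes the simplex. -/
def freeRegion (κ : Type*) [Fintype κ] : Set (κ → ℝ) :=
  {x | (∀ i, 0 ≤ x i) ∧ ∑ i, x i ≤ 1}

theorem volume_freeRegion_lt_top (κ : Type*) [Fintype κ] : volume (freeRegion κ) < ⊤ := by
  refine (Metric.isBounded_Icc (0 : κ → ℝ) 1).subset ?_ |>.measure_lt_top
  intro x hx
  refine ⟨hx.1, fun i => le_trans ?_ hx.2⟩
  exact Finset.single_le_sum (fun i _ => hx.1 i) (Finset.mem_univ i)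

instance isFiniteMeasure_restrict_freeRegion (κ : Type*) [Fintype κ] :
    IsFiniteMeasure ((volume : Measure (κ → ℝ)).restrict (freeRegion κ)) :=
  ⟨by simpa using volume_freeRegion_lt_top κ⟩

instance isFiniteMeasure_simplexMeasure (ι : Type*) [Fintype ι] [DecidableEq ι] [Nonempty ι] :
    IsFiniteMeasure (simplexMeasure ι) :=
  inferInstanceAs (IsFiniteMeasure (Measure.map _ (volume.restrict (freeRegion _))))

theorem simplexPoint_surjOn {ι : Type*} [Fintype ι] [DecidableEq ι] (i₀ : ι) {p : ι → ℝ}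
    (hp : p ∈ stdSimplex ℝ ι) : simplexPoint i₀ (fun i => p i) = p := by
  ext i
  unfold simplexPoint
  split_ifs with h
  · subst h
    have := hp.2
    rw [← Finset.add_sum_erase _ _ (Finset.mem_univ i)] at this
    rw [← this, Finset.sum_subtype (Finset.univ.erase i) (p := fun k => k ≠ i) (by simp) p]
    ring
  · rfl

theorem contDiff_simplexPoint {ι : Type*} [Fintype ι] [DecidableEq ι] (i₀ : ι) :
    ContDiff ℝ ω (simplexPoint i₀) := by
  refine contDiff_pi.2 fun i => ?_
  unfold simplexPoint
  split_ifs <;> fun_prop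

/-- Free coordinates of the whole parameter space. -/
abbrev FreeParam (Q : Fin J → ℕ) [∀ j, NeZero (Q j)] [NeZero C] (Δ : Fin J → Fin C → Fin D) :
    Type :=
  ({i : Fin C // i ≠ Classical.arbitrary (Fin C)} → ℝ) ×
    ∀ c d, {i : Pattern Q (domainItems Δ c d) // i ≠ Classical.arbitrary _} → ℝ

/-- The chart from free coordinates to parameters. -/
noncomputable def freeChart (Q : Fin J → ℕ) [∀ j, NeZero (Q j)] [NeZero C]
    (Δ : Fin J → Fin C → Fin D) :
    FreeParam Q Δ → Param Q Δ :=
  Prod.map (simplexPoint _) fun x c d => simplexPoint _ (x c d)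

theorem contDiff_freeChart (Q : Fin J → ℕ) [∀ j, NeZero (Q j)] [NeZero C]
    (Δ : Fin J → Fin C → Fin D) : ContDiff ℝ ω (freeChart Q Δ) := by
  refine ((contDiff_simplexPoint _).comp contDiff_fst).prodMk ?_
  refine contDiff_pi.2 fun c => contDiff_pi.2 fun d => (contDiff_simplexPoint _).comp ?_
  exact contDiff_pi.1 (contDiff_pi.1 contDiff_snd c) d

/-- The simplices are null in their ambient spaces, so null sets have to be tested in free
coordinates. Products of pushforwards are pushforwards of products, and restricting to the free
regions only shrinks the measure. -/
theorem paramMeasure_absolutelyContinuous (Q : Fin J → ℕ) [∀ j, NeZero (Q j)] [NeZero C]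
    (Δ : Fin J → Fin C → Fin D) :
    paramMeasure Q Δ ≪ Measure.map (freeChart Q Δ) volume := by
  have hinner : ∀ c, (Measure.pi fun d => simplexMeasure (Pattern Q (domainItems Δ c d))) =
      Measure.map (fun x d => simplexPoint (Classical.arbitrary _) (x d))
        (Measure.pi fun d => volume.restrict
          (freeRegion {i : Pattern Q (domainItems Δ c d) // i ≠ Classical.arbitrary _})) := by
    intro c
    have hfin : ∀ d, SigmaFinite (Measure.map
        (simplexPoint (Classical.arbitrary (Pattern Q (domainItems Δ c d))))
        (volume.restrict {x | (∀ i, 0 ≤ x i) ∧ ∑ i, x i ≤ 1})) := fun d =>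
      inferInstanceAs (SigmaFinite (simplexMeasure _))
    exact (Measure.pi_map_pi fun d => (measurable_simplexPoint _).aemeasurable).symm
  have hmeas : ∀ c, Measurable fun (x : ∀ d, {i : Pattern Q (domainItems Δ c d) //
      i ≠ Classical.arbitrary _} → ℝ) d => simplexPoint (Classical.arbitrary _) (x d) := fun c =>
    measurable_pi_lambda _ fun d => (measurable_simplexPoint _).comp (measurable_pi_apply d)
  have houter : (Measure.pi fun c => Measure.pi fun d =>
      simplexMeasure (Pattern Q (domainItems Δ c d))) =
      Measure.map (fun x c d => simplexPoint (Classical.arbitrary _) (x c d))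
        (Measure.pi fun c => Measure.pi fun d => volume.restrict
          (freeRegion {i : Pattern Q (domainItems Δ c d) // i ≠ Classical.arbitrary _})) := by
    simp_rw [hinner]
    exact (Measure.pi_map_pi fun c => (hmeas c).aemeasurable).symm
  have hmeas' : Measurable fun (x : ∀ c d, {i : Pattern Q (domainItems Δ c d) //
      i ≠ Classical.arbitrary _} → ℝ) c d => simplexPoint (Classical.arbitrary _) (x c d) :=
    measurable_pi_lambda _ fun c => (hmeas c).comp (measurable_pi_apply c)
  have hmain : paramMeasure Q Δ = Measure.map (freeChart Q Δ)
      ((volume.restrict (freeRegion _)).prod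
        (Measure.pi fun c => Measure.pi fun d => volume.restrict (freeRegion _))) := by
    rw [paramMeasure, houter]
    exact Measure.map_prod_map _ _ (measurable_simplexPoint _) hmeas'
  rw [hmain]
  refine Measure.AbsolutelyContinuous.map ?_ (contDiff_freeChart Q Δ).continuous.measurable
  refine Measure.AbsolutelyContinuous.prod Measure.restrict_le_self.absolutelyContinuous ?_
  simp_rw [← Measure.restrict_pi_pi]
  exact Measure.restrict_le_self.absolutelyContinuous

theorem paramMeasure_zeroSet (Q : Fin J → ℕ) [∀ j, NeZero (Q j)] [NeZero C]
    (Δ : Fin J → Fin C → Fin D) {f : Param Q Δ → ℝ} (hf : ContDiff ℝ ω f) {ω₀ : Param Q Δ}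
    (hω₀ : ω₀ ∈ paramSpace Q Δ) (h₀ : f ω₀ ≠ 0) : paramMeasure Q Δ {x | f x = 0} = 0 := by
  refine paramMeasure_absolutelyContinuous Q Δ ?_
  have hc := contDiff_freeChart Q Δ
  rw [Measure.map_apply hc.continuous.measurable
    (isClosed_eq hf.continuous continuous_const).measurableSet]
  have : (volume : Measure (FreeParam Q Δ)).IsAddHaarMeasure := by
    have (c : Fin C) : Measure.IsAddHaarMeasure (volume : Measure (∀ d,
        {i : Pattern Q (domainItems Δ c d) // i ≠ Classical.arbitrary _} → ℝ)) := by
      rw [volume_pi]; infer_instance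
    have : Measure.IsAddHaarMeasure (volume : Measure (∀ c d,
        {i : Pattern Q (domainItems Δ c d) // i ≠ Classical.arbitrary _} → ℝ)) := by
      rw [volume_pi]; infer_instance
    rw [Measure.volume_eq_prod]; infer_instance
  refine addHaar_zeroSet volume (hf.comp hc)
    (x₀ := (fun i => ω₀.1 i, fun c d i => ω₀.2 c d i)) ?_
  have : freeChart Q Δ (fun i => ω₀.1 i, fun c d i => ω₀.2 c d i) = ω₀ := by
    refine Prod.ext (simplexPoint_surjOn _ hω₀.1) ?_
    funext c d
    exact simplexPoint_surjOn _ (hω₀.2 c d)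
  simpa [this] using h₀

end DLCM

namespace DLCM

/-! ### Families of product tensors that do not split -/

variable {K ι I I' : Type*} [Field K]

/-- The span of the vectors of the family `x` with index in `S`. -/
abbrev famSpan (x : ι → I → K) (S : Finset ι) : Submodule K (I → K) :=
  Submodule.span K (x '' (S : Set ι))

/-- The dimension of the span of the vectors of the family `x` with index in `S`. -/
noncomputable def famDim (x : ι → I → K) (S : Finset ι) : ℕ :=
  Module.finrank K (famSpan x S)

theorem mem_famSpan (x : ι → I → K) {S : Finset ι} {a : ι} (ha : a ∈ S) : x a ∈ famSpan x S :=
  Submodule.subset_span ⟨a, ha, rfl⟩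

theorem famSpan_le {x : ι → I → K} {S : Finset ι} {p : Submodule K (I → K)}
    (h : ∀ a ∈ S, x a ∈ p) : famSpan x S ≤ p :=
  Submodule.span_le.2 (by rintro _ ⟨a, ha, rfl⟩; exact h a ha)

theorem famSpan_mono (x : ι → I → K) {S T : Finset ι} (h : S ⊆ T) : famSpan x S ≤ famSpan x T :=
  famSpan_le fun _ ha => mem_famSpan x (h ha)

theorem famSpan_union [DecidableEq ι] (x : ι → I → K) (S T : Finset ι) :
    famSpan x (S ∪ T) = famSpan x S ⊔ famSpan x T := by
  simp [famSpan, Set.image_union, Submodule.span_union]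

theorem sum_smul_mem_famSpan (x : ι → I → K) (S : Finset ι) (c : ι → K) :
    ∑ a ∈ S, c a • x a ∈ famSpan x S :=
  Submodule.sum_mem _ fun _ ha => Submodule.smul_mem _ _ (mem_famSpan x ha)

theorem sum_mem_famSpan (x : ι → I → K) (S : Finset ι) : ∑ a ∈ S, x a ∈ famSpan x S :=
  Submodule.sum_mem _ fun _ ha => mem_famSpan x ha

theorem exists_sum_of_mem_famSpan {x : ι → I → K} {S : Finset ι} {z : I → K}
    (hz : z ∈ famSpan x S) : ∃ c : ι → K, z = ∑ a ∈ S, c a • x a := by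
  classical
  obtain ⟨c, hc⟩ := (Submodule.mem_span_image_finset_iff_exists_fun K).1 hz
  refine ⟨fun a => if h : a ∈ S then c ⟨a, h⟩ else 0, ?_⟩
  rw [← hc, ← Finset.sum_coe_sort S]
  simp

theorem famDim_le_card [Finite I] (x : ι → I → K) (S : Finset ι) : famDim x S ≤ S.card := by
  classical
  have h := finrank_span_finset_le_card (R := K) (S.image x)
  rw [Finset.coe_image] at h
  exact h.trans Finset.card_image_le

theorem famDim_mono [Finite I] (x : ι → I → K) {S T : Finset ι} (h : S ⊆ T) :
    famDim x S ≤ famDim x T :=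
  Submodule.finrank_mono (famSpan_mono x h)

/-- The family splits on `E`: two nonempty complementary parts have independent spans. -/
def Splits [DecidableEq ι] (x : ι → I → K) (E : Finset ι) : Prop :=
  ∃ E₁ E₂ : Finset ι, E₁.Nonempty ∧ E₂.Nonempty ∧ Disjoint E₁ E₂ ∧ E₁ ∪ E₂ = E ∧
    Disjoint (famSpan x E₁) (famSpan x E₂)

/-- The family of the products of two families. -/
def tensor (u : ι → I → K) (v : ι → I' → K) : ι → I × I' → K :=
  fun a p => u a p.1 * v a p.2

theorem tensor_ne_zero {u : ι → I → K} {v : ι → I' → K} {a : ι} (hu : u a ≠ 0) (hv : v a ≠ 0) :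
    tensor u v a ≠ 0 := by
  obtain ⟨i, hi⟩ := Function.ne_iff.1 hu
  obtain ⟨j, hj⟩ := Function.ne_iff.1 hv
  exact Function.ne_iff.2 ⟨(i, j), mul_ne_zero hi hj⟩

theorem slice_right_mem {u : ι → I → K} {v : ι → I' → K} {S : Finset ι} {z : I × I' → K}
    (hz : z ∈ famSpan (tensor u v) S) (i : I) : (fun j => z (i, j)) ∈ famSpan v S := by
  obtain ⟨c, rfl⟩ := exists_sum_of_mem_famSpan hz
  convert sum_smul_mem_famSpan v S (fun a => c a * u a i) using 1
  ext j
  simp [tensor, mul_assoc]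

theorem slice_left_mem {u : ι → I → K} {v : ι → I' → K} {S : Finset ι} {z : I × I' → K}
    (hz : z ∈ famSpan (tensor u v) S) (j : I') : (fun i => z (i, j)) ∈ famSpan u S := by
  obtain ⟨c, rfl⟩ := exists_sum_of_mem_famSpan hz
  convert sum_smul_mem_famSpan u S (fun a => c a * v a j) using 1
  ext i
  simp [tensor, mul_comm, mul_left_comm]

theorem Splits.tensor_right [DecidableEq ι] {u : ι → I → K} {v : ι → I' → K} {E : Finset ι}
    (h : Splits v E) : Splits (tensor u v) E := by
  obtain ⟨E₁, E₂, h₁, h₂, hd, hE, hs⟩ := h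
  refine ⟨E₁, E₂, h₁, h₂, hd, hE, Submodule.disjoint_def.2 fun z hz₁ hz₂ => ?_⟩
  ext ⟨i, j⟩
  exact congrFun (Submodule.disjoint_def.1 hs _ (slice_right_mem hz₁ i) (slice_right_mem hz₂ i)) j

/-- A functional that kills `U` and the other `u a`, `a ∈ S`, but not `u s`, turns the relations
`hrel` into a linear relation among the `v a` in which `s` is the only surviving index of `S`. -/
theorem exchange [DecidableEq ι] {u : ι → I → K} {v : ι → I' → K} {D S : Finset ι}
    {U : Submodule K (I → K)} {c : ι → K} (hc : ∀ a ∈ D, c a ≠ 0)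
    (hrel : ∀ j, ∑ a ∈ D, (c a * v a j) • u a ∈ U) (hSD : S ⊆ D) {s : ι} (hs : s ∈ S)
    (hus : u s ∉ U ⊔ famSpan u (S.erase s)) : v s ∈ famSpan v (D \ S) := by
  obtain ⟨f, hfs, hf⟩ := Submodule.exists_dual_map_eq_bot_of_notMem hus inferInstance
  have hf0 : ∀ x ∈ U ⊔ famSpan u (S.erase s), f x = 0 := fun x hx => by
    have : f x ∈ (U ⊔ famSpan u (S.erase s)).map f := Submodule.mem_map_of_mem hx
    rwa [hf, Submodule.mem_bot] at this
  have hsum : ∑ a ∈ D, (c a * f (u a)) • v a = 0 := by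
    ext j
    have := hf0 _ (Submodule.mem_sup_left (hrel j))
    rw [map_sum] at this
    rw [Finset.sum_apply, Pi.zero_apply, ← this]
    refine Finset.sum_congr rfl fun a _ => ?_
    simp only [Pi.smul_apply, map_smul, smul_eq_mul]
    ring
  rw [← Finset.sum_sdiff hSD, Finset.sum_eq_single_of_mem s hs] at hsum
  · have h1 : (c s * f (u s)) • v s ∈ famSpan v (D \ S) := by
      rw [← neg_eq_of_add_eq_zero_right hsum]
      exact Submodule.neg_mem _ (sum_smul_mem_famSpan _ _ _)
    exact (Submodule.smul_mem_iff _ (mul_ne_zero (hc s (hSD hs)) hfs)).1 h1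
  · intro b hb hbs
    rw [hf0 _ (Submodule.mem_sup_right (mem_famSpan u (Finset.mem_erase.2 ⟨hbs, hb⟩)))]
    simp

/-- Slices of `z` give relations modulo the spans over `F`. By `exchange`, directions that are new
for `u` are redundant for `v`, so the indices of `D` are shared between the two factors instead of
being counted twice. -/
theorem famDim_union_le [DecidableEq ι] [Finite I] [Finite I'] {u : ι → I → K} {v : ι → I' → K}
    {F D : Finset ι} {c : ι → K} {z : I × I' → K} (hc : ∀ a ∈ D, c a ≠ 0)
    (hz : z = ∑ a ∈ D, c a • tensor u v a) (hz0 : z ≠ 0) (hzF : z ∈ famSpan (tensor u v) F) :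
    famDim u (F ∪ D) + famDim v (F ∪ D) + 1 ≤ famDim u F + famDim v F + D.card := by
  classical
  have hrelu : ∀ j, ∑ a ∈ D, (c a * v a j) • u a ∈ famSpan u F := fun j => by
    convert slice_left_mem hzF j using 1
    ext i
    simp [hz, tensor, mul_comm, mul_left_comm]
  have hrelv : ∀ i, ∑ a ∈ D, (c a * u a i) • v a ∈ famSpan v F := fun i => by
    convert slice_right_mem hzF i using 1
    ext j
    simp [hz, tensor, mul_assoc]
  -- By minimality no `u s` with `s ∈ S` is spanned by `F` and the rest of `S`, as `exchange`
  -- requires. This yields the bound without the `+ 1`.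
  obtain ⟨S, hS, hSmin⟩ := Finset.exists_min_image
    (D.powerset.filter fun S => famSpan u D ≤ famSpan u F ⊔ famSpan u S) Finset.card
    ⟨D, by simp⟩
  rw [Finset.mem_filter, Finset.mem_powerset] at hS
  obtain ⟨hSD, hSle⟩ := hS
  have hvS : ∀ s ∈ S, v s ∈ famSpan v (D \ S) := fun s hs => by
    refine exchange hc hrelu hSD hs fun hus => ?_
    have hle : famSpan u D ≤ famSpan u F ⊔ famSpan u (S.erase s) := by
      refine hSle.trans (sup_le le_sup_left (famSpan_le fun a ha => ?_))
      by_cases has : a = s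
      · rwa [has]
      · exact Submodule.mem_sup_right (mem_famSpan u (Finset.mem_erase.2 ⟨has, ha⟩))
    have := hSmin (S.erase s)
      (Finset.mem_filter.2 ⟨Finset.mem_powerset.2 ((Finset.erase_subset _ _).trans hSD), hle⟩)
    exact (Finset.card_erase_lt_of_mem hs).not_ge this
  have hvD : famSpan v D ≤ famSpan v (D \ S) := famSpan_le fun a ha => by
    by_cases haS : a ∈ S
    · exact hvS a haS
    · exact mem_famSpan v (Finset.mem_sdiff.2 ⟨ha, haS⟩)
  have hcard : (D \ S).card + S.card = D.card := Finset.card_sdiff_add_card_eq_card hSD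
  have hu1 : famDim u (F ∪ D) ≤ Module.finrank K ↥(famSpan u F ⊔ famSpan u S) := by
    refine Submodule.finrank_mono ?_
    rw [famSpan_union]
    exact sup_le le_sup_left hSle
  have hinf := Submodule.finrank_sup_add_finrank_inf_eq (famSpan u F) (famSpan u S)
  have hdS := famDim_le_card u S
  have hdT := famDim_le_card v (D \ S)
  have hv1 : famDim v (F ∪ D) ≤ famDim v F + famDim v (D \ S) := by
    refine le_trans (Submodule.finrank_mono ?_)
      (Submodule.finrank_add_le_finrank_add_finrank (famSpan v F) (famSpan v (D \ S)))
    rw [famSpan_union]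
    exact sup_le_sup_left hvD _
  -- Failure means equality in every estimate. Then `exchange` also works with `u` and `v` swapped,
  -- and the spans of `u` over `F` and `S` meet only in zero; the slices of `z` lie in both, which
  -- contradicts `z ≠ 0`.
  by_contra hlt
  have huT : ∀ t ∈ D \ S, u t ∈ famSpan u (D \ (D \ S)) := fun t ht => by
    refine exchange hc hrelv Finset.sdiff_subset ht fun hvt => ?_
    have h2 : famDim v (F ∪ D) ≤ famDim v F + famDim v ((D \ S).erase t) := by
      refine le_trans (Submodule.finrank_mono ?_)
        (Submodule.finrank_add_le_finrank_add_finrank (famSpan v F) (famSpan v ((D \ S).erase t)))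
      rw [famSpan_union]
      refine sup_le le_sup_left (hvD.trans (famSpan_le fun a ha => ?_))
      by_cases hat : a = t
      · rwa [hat]
      · exact Submodule.mem_sup_right (mem_famSpan v (Finset.mem_erase.2 ⟨hat, ha⟩))
    have h3 := famDim_le_card v ((D \ S).erase t)
    have h4 := Finset.card_erase_lt_of_mem ht
    unfold famDim at *
    omega
  rw [Finset.sdiff_sdiff_eq_self hSD] at huT
  have huD : famSpan u D ≤ famSpan u S := famSpan_le fun a ha => by
    by_cases haS : a ∈ S
    · exact mem_famSpan u haS
    · exact huT a (Finset.mem_sdiff.2 ⟨ha, haS⟩)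
  have hinf0 : Module.finrank K ↥(famSpan u F ⊓ famSpan u S) = 0 := by
    unfold famDim at *
    omega
  rw [Submodule.finrank_eq_zero] at hinf0
  refine hz0 (funext fun p => ?_)
  have hmem : (fun i => z (i, p.2)) ∈ famSpan u F ⊓ famSpan u S := by
    refine ⟨slice_left_mem hzF p.2, huD ?_⟩
    refine slice_left_mem (v := v) ?_ p.2
    rw [hz]
    exact sum_smul_mem_famSpan _ _ _
  rw [hinf0, Submodule.mem_bot] at hmem
  exact congrFun hmem p.1

theorem famSpan_erase_of_mem [DecidableEq ι] {x : ι → I → K} {D : Finset ι} {a : ι}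
    (h : x a ∈ famSpan x (D.erase a)) : famSpan x D ≤ famSpan x (D.erase a) :=
  famSpan_le fun b hb => by
    by_cases hba : b = a
    · rwa [hba]
    · exact mem_famSpan x (Finset.mem_erase.2 ⟨hba, hb⟩)

/-- The span of a family of product vectors that does not split is large. -/
theorem famDim_add_le_of_not_splits [DecidableEq ι] [Finite I] [Finite I'] {u : ι → I → K}
    {v : ι → I' → K} {E : Finset ι} (hE : E.Nonempty) (hu : ∀ a ∈ E, u a ≠ 0)
    (hv : ∀ a ∈ E, v a ≠ 0) (hns : ¬ Splits (tensor u v) E) :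
    famDim u E + famDim v E ≤ famDim (tensor u v) E + 1 := by
  classical
  obtain ⟨F, hF, hFmax⟩ := Finset.exists_max_image
    (E.powerset.filter fun F => F.Nonempty ∧
      famDim u F + famDim v F ≤ famDim (tensor u v) F + 1) Finset.card (by
    obtain ⟨a, ha⟩ := hE
    refine ⟨{a}, Finset.mem_filter.2 ⟨by simpa using ha, by simp, ?_⟩⟩
    have h1 : famDim (tensor u v) {a} = 1 := by
      rw [famDim, famSpan, Finset.coe_singleton, Set.image_singleton]
      exact finrank_span_singleton (tensor_ne_zero (hu a ha) (hv a ha))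
    have h2 := famDim_le_card u {a}
    have h3 := famDim_le_card v {a}
    simp only [Finset.card_singleton] at h2 h3
    omega)
  rw [Finset.mem_filter, Finset.mem_powerset] at hF
  obtain ⟨hFE, hFne, hFle⟩ := hF
  by_cases hFeq : F = E
  · rwa [← hFeq]
  have hGne : (E \ F).Nonempty := Finset.sdiff_nonempty.2 fun h => hFeq (hFE.antisymm h)
  have hnd : ¬ Disjoint (famSpan (tensor u v) (E \ F)) (famSpan (tensor u v) F) := fun hd =>
    hns ⟨E \ F, F, hGne, hFne, Finset.sdiff_disjoint, Finset.sdiff_union_of_subset hFE, hd⟩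
  -- A minimal `D` whose span meets that of `F` has independent vectors and only nonzero
  -- coefficients in the common vector. Adding it raises the tensor dimension by at least `D.card -
  -- 1` and the sum of factor dimensions by at most that, against the maximality of `F`.
  obtain ⟨D, hD, hDmin⟩ := Finset.exists_min_image
    ((E \ F).powerset.filter fun D =>
      ¬ Disjoint (famSpan (tensor u v) D) (famSpan (tensor u v) F)) Finset.card
    ⟨E \ F, Finset.mem_filter.2 ⟨by simp, hnd⟩⟩
  rw [Finset.mem_filter, Finset.mem_powerset] at hD
  obtain ⟨hDE, hDnd⟩ := hD
  have hmin : ∀ a ∈ D, Disjoint (famSpan (tensor u v) (D.erase a)) (famSpan (tensor u v) F) :=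
    fun a ha => by
      by_contra hnd'
      have := hDmin (D.erase a) (Finset.mem_filter.2
        ⟨Finset.mem_powerset.2 ((Finset.erase_subset _ _).trans hDE), hnd'⟩)
      exact (Finset.card_erase_lt_of_mem ha).not_ge this
  have hnmem : ∀ a ∈ D, tensor u v a ∉ famSpan (tensor u v) (D.erase a) := fun a ha hmem =>
    hDnd ((hmin a ha).mono_left (famSpan_erase_of_mem hmem))
  rw [Submodule.disjoint_def] at hDnd
  push Not at hDnd
  obtain ⟨z, hzD, hzF, hz0⟩ := hDnd
  obtain ⟨c, hzc⟩ := exists_sum_of_mem_famSpan hzD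
  have hc : ∀ a ∈ D, c a ≠ 0 := fun a ha hca => by
    refine hz0 (Submodule.disjoint_def.1 (hmin a ha) z ?_ hzF)
    rw [hzc, ← Finset.add_sum_erase _ _ ha, hca, zero_smul, zero_add]
    exact sum_smul_mem_famSpan _ _ _
  have hincr := famDim_union_le hc hzc hz0 hzF
  have hDne : D.Nonempty := by
    rw [Finset.nonempty_iff_ne_empty]
    rintro rfl
    exact hz0 (by simpa using hzc)
  obtain ⟨a₀, ha₀⟩ := hDne
  have hli : famDim (tensor u v) (D.erase a₀) = (D.erase a₀).card := by
    have : LinearIndepOn K (tensor u v) (D.erase a₀ : Finset ι) := by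
      rw [linearIndepOn_iff_notMem_span]
      intro a ha hmem
      refine hnmem a (Finset.mem_of_mem_erase ha) (Submodule.span_mono (Set.image_mono ?_) hmem)
      intro b hb
      simp only [Finset.coe_erase, Set.mem_sdiff, Finset.mem_coe, Set.mem_singleton_iff] at hb ⊢
      exact ⟨hb.1.1, hb.2⟩
    have h2 := finrank_span_eq_card this
    rw [famDim, famSpan, Set.image_eq_range]
    exact h2.trans (Fintype.card_coe _)
  have hdim : famDim (tensor u v) F + (D.erase a₀).card ≤ famDim (tensor u v) (F ∪ D) := by
    have h := Submodule.finrank_sup_add_finrank_inf_eq (famSpan (tensor u v) (D.erase a₀))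
      (famSpan (tensor u v) F)
    rw [(hmin a₀ ha₀).eq_bot, finrank_bot, add_zero] at h
    rw [← hli, add_comm, famDim, famDim, ← h]
    refine Submodule.finrank_mono ?_
    rw [famSpan_union, sup_comm]
    exact sup_le_sup_left (famSpan_mono _ (Finset.erase_subset _ _)) _
  have hcard := Finset.card_erase_add_one ha₀
  have hFD := hFmax (F ∪ D) (Finset.mem_filter.2
    ⟨Finset.mem_powerset.2 (Finset.union_subset hFE (hDE.trans Finset.sdiff_subset)),
      hFne.mono Finset.subset_union_left, by omega⟩)
  rw [Finset.card_union_of_disjoint] at hFD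
  · have := Finset.card_pos.2 ⟨a₀, ha₀⟩
    omega
  · exact Finset.disjoint_of_subset_right hDE Finset.disjoint_sdiff

/-! ### Uniqueness of a sum of product tensors -/

variable {I₀ I₁ I₂ : Type*}

/-- The equation is a linear relation on `S ∪ T`. When the family splits, the relation breaks into
one on each part, and induction applies to both. -/
theorem sum_tensor_unique [DecidableEq ι] [Finite I₀] [Finite I₁] [Finite I₂] {u : ι → I₀ → K}
    {v : ι → I₁ → K} {w : ι → I₂ → K} (n : ℕ) : ∀ S T : Finset ι, S.card + T.card ≤ n →
    Disjoint S T → T.card ≤ S.card → (∀ a ∈ S ∪ T, u a ≠ 0) → (∀ a ∈ S ∪ T, v a ≠ 0) →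
    (∀ a ∈ S ∪ T, w a ≠ 0) →
    (∀ S' ⊆ S, 2 ≤ S'.card → 2 * S'.card + 2 ≤ famDim u S' + famDim v S' + famDim w S') →
    ∑ a ∈ S, tensor u (tensor v w) a = ∑ a ∈ T, tensor u (tensor v w) a →
    S.val.map (tensor u (tensor v w)) = T.val.map (tensor u (tensor v w)) := by
  induction n with
  | zero =>
    intro S T hn _ _ _ _ _ _ _
    have hS : S = ∅ := Finset.card_eq_zero.1 (by omega)
    have hT : T = ∅ := Finset.card_eq_zero.1 (by omega)
    rw [hS, hT]
  | succ n ih =>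
    intro S T hn hST hcard hu hv hw hdim hsum
    have hx0 : ∀ a ∈ S ∪ T, tensor u (tensor v w) a ≠ 0 := fun a ha =>
      tensor_ne_zero (hu a ha) (tensor_ne_zero (hv a ha) (hw a ha))
    rcases Nat.lt_or_ge S.card 2 with hS2 | hS2
    · rcases Nat.lt_or_ge S.card 1 with hS1 | hS1
      · have hS : S = ∅ := Finset.card_eq_zero.1 (by omega)
        have hT : T = ∅ := Finset.card_eq_zero.1 (by omega)
        rw [hS, hT]
      · obtain ⟨a, rfl⟩ := Finset.card_eq_one.1 (by omega : S.card = 1)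
        rcases Nat.lt_or_ge T.card 1 with hT1 | hT1
        · have hT : T = ∅ := Finset.card_eq_zero.1 (by omega)
          rw [hT] at hsum
          exact absurd (by simpa using hsum) (hx0 a (by simp))
        · obtain ⟨b, rfl⟩ := Finset.card_eq_one.1 (by omega : T.card = 1)
          simpa using hsum
    set x := tensor u (tensor v w) with hx
    have hEcard : (S ∪ T).card = S.card + T.card := Finset.card_union_of_disjoint hST
    have hSne : S.Nonempty := Finset.card_pos.1 (by omega)
    have hsplit : Splits x (S ∪ T) := by
      -- Without a split the three dimensions add up to at most `famDim x (S ∪ T) + 2`. The relation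
      -- makes the family dependent, so this is at most `S.card + T.card + 1 ≤ 2 * S.card + 1`, one
      -- below what `hdim` demands.
      by_contra hns
      have h1 := famDim_add_le_of_not_splits (v := tensor v w) (hSne.mono Finset.subset_union_left) hu
        (fun a ha => tensor_ne_zero (hv a ha) (hw a ha)) hns
      rw [← hx] at h1
      have h2 := famDim_add_le_of_not_splits (hSne.mono Finset.subset_union_left) hv hw
        fun h => hns h.tensor_right
      have h3 := hdim S subset_rfl hS2
      have h4 := famDim_mono u (Finset.subset_union_left (s₁ := S) (s₂ := T))
      have h5 := famDim_mono v (Finset.subset_union_left (s₁ := S) (s₂ := T))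
      have h6 := famDim_mono w (Finset.subset_union_left (s₁ := S) (s₂ := T))
      obtain ⟨a, ha⟩ := hSne
      have hmem : x a ∈ famSpan x ((S ∪ T).erase a) := by
        rw [← Finset.add_sum_erase _ _ ha] at hsum
        rw [eq_sub_of_add_eq hsum]
        refine Submodule.sub_mem _ (famSpan_mono x ?_ (sum_mem_famSpan x T))
          (famSpan_mono x ?_ (sum_mem_famSpan x _))
        · intro b hb
          refine Finset.mem_erase.2 ⟨?_, Finset.mem_union_right _ hb⟩
          rintro rfl
          exact Finset.disjoint_left.1 hST ha hb
        · exact Finset.erase_subset_erase _ Finset.subset_union_left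
      have h7 : famDim x (S ∪ T) ≤ famDim x ((S ∪ T).erase a) :=
        Submodule.finrank_mono (famSpan_erase_of_mem hmem)
      have h8 := famDim_le_card x ((S ∪ T).erase a)
      have h9 := Finset.card_erase_add_one (Finset.mem_union_left T ha)
      omega
    obtain ⟨E₁, E₂, hne₁, hne₂, hdE, hE, hd⟩ := hsplit
    have hparts : ∀ R ⊆ S ∪ T, (R ∩ E₁) ∪ (R ∩ E₂) = R ∧ Disjoint (R ∩ E₁) (R ∩ E₂) :=
      fun R hR => ⟨by rw [← Finset.inter_union_distrib_left, hE, Finset.inter_eq_left.2 hR],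
        Finset.disjoint_of_subset_left Finset.inter_subset_right
          (Finset.disjoint_of_subset_right Finset.inter_subset_right hdE)⟩
    obtain ⟨hSu, hSd⟩ := hparts S Finset.subset_union_left
    obtain ⟨hTu, hTd⟩ := hparts T Finset.subset_union_right
    have hSc := Finset.card_union_of_disjoint hSd
    have hTc := Finset.card_union_of_disjoint hTd
    rw [hSu] at hSc
    rw [hTu] at hTc
    have hE₁c : (S ∩ E₁).card + (T ∩ E₁).card = E₁.card := by
      rw [← Finset.card_union_of_disjoint (Finset.disjoint_of_subset_left Finset.inter_subset_left
          (Finset.disjoint_of_subset_right Finset.inter_subset_left hST)),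
        ← Finset.union_inter_distrib_right, ← hE, Finset.inter_eq_right.2 Finset.subset_union_left]
    have hE₂c : (S ∩ E₂).card + (T ∩ E₂).card = E₂.card := by
      rw [← Finset.card_union_of_disjoint (Finset.disjoint_of_subset_left Finset.inter_subset_left
          (Finset.disjoint_of_subset_right Finset.inter_subset_left hST)),
        ← Finset.union_inter_distrib_right, ← hE, Finset.inter_eq_right.2 Finset.subset_union_right]
    have hpos₁ := Finset.card_pos.2 hne₁
    have hpos₂ := Finset.card_pos.2 hne₂
    have hsum' : (∑ a ∈ S ∩ E₁, x a) - ∑ a ∈ T ∩ E₁, x a =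
        (∑ a ∈ T ∩ E₂, x a) - ∑ a ∈ S ∩ E₂, x a := by
      rw [← hSu, ← hTu, Finset.sum_union hSd, Finset.sum_union hTd] at hsum
      rw [sub_eq_sub_iff_add_eq_add, hsum, add_comm]
    have hzero : (∑ a ∈ S ∩ E₁, x a) - ∑ a ∈ T ∩ E₁, x a = 0 := by
      refine Submodule.disjoint_def.1 hd _ ?_ ?_
      · exact Submodule.sub_mem _ (famSpan_mono x Finset.inter_subset_right (sum_mem_famSpan x _))
          (famSpan_mono x Finset.inter_subset_right (sum_mem_famSpan x _))
      · rw [hsum']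
        exact Submodule.sub_mem _ (famSpan_mono x Finset.inter_subset_right (sum_mem_famSpan x _))
          (famSpan_mono x Finset.inter_subset_right (sum_mem_famSpan x _))
    have key : ∀ R, (S ∩ R).card + (T ∩ R).card ≤ n →
        (T ∩ R).card ≤ (S ∩ R).card → ∑ a ∈ S ∩ R, x a = ∑ a ∈ T ∩ R, x a →
        (S ∩ R).val.map x = (T ∩ R).val.map x := by
      intro R hn' hle hs
      have hsub : S ∩ R ∪ T ∩ R ⊆ S ∪ T :=
        Finset.union_subset_union Finset.inter_subset_left Finset.inter_subset_left
      exact ih _ _ hn' (Finset.disjoint_of_subset_left Finset.inter_subset_left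
          (Finset.disjoint_of_subset_right Finset.inter_subset_left hST)) hle
        (fun a ha => hu a (hsub ha)) (fun a ha => hv a (hsub ha)) (fun a ha => hw a (hsub ha))
        (fun S' hS' => hdim S' (hS'.trans Finset.inter_subset_left)) hs
    have key₁ := key E₁
    have key₂ := key E₂
    have hcard_of : ∀ R, (S ∩ R).val.map x = (T ∩ R).val.map x → (S ∩ R).card = (T ∩ R).card := by
      intro R h
      simpa only [Multiset.card_map, Finset.card_val] using congrArg Multiset.card h
    have hs₁ := sub_eq_zero.1 hzero
    have hs₂ := (sub_eq_zero.1 (hsum'.symm.trans hzero)).symm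
    -- If `T` were larger on one part, it would be strictly smaller on the other, where induction
    -- applies and forces equal cardinalities.
    have hle₁ : (T ∩ E₁).card ≤ (S ∩ E₁).card := by
      by_contra hlt
      have := hcard_of E₂ (key₂ (by omega) (by omega) hs₂)
      omega
    have hle₂ : (T ∩ E₂).card ≤ (S ∩ E₂).card := by
      by_contra hlt
      have := hcard_of E₁ (key₁ (by omega) (by omega) hs₁)
      omega
    have m₁ := key₁ (by omega) hle₁ hs₁
    have m₂ := key₂ (by omega) hle₂ hs₂
    have hval : ∀ A B : Finset ι, Disjoint A B → (A ∪ B).val = A.val + B.val := fun A B h => by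
      rw [← Finset.disjUnion_eq_union A B h]
      rfl
    rw [← hSu, ← hTu, hval _ _ hSd, hval _ _ hTd, Multiset.map_add, Multiset.map_add, m₁, m₂]

end DLCM

namespace DLCM

/-! ### Kruskal's theorem for weighted sums, and permutations from equal multisets or equal fibers
-/

section Decomposition

variable {K ι I I' I₀ I₁ I₂ : Type*} [Field K]

theorem exists_perm_of_map_univ_eq {α β : Type*} [Fintype α] {f g : α → β}
    (h : (Finset.univ : Finset α).val.map f = (Finset.univ : Finset α).val.map g) :
    ∃ σ : Equiv.Perm α, ∀ a, f a = g (σ a) := by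
  classical
  have hcard : ∀ z, Nonempty ({a // f a = z} ≃ {a // g a = z}) := fun z => by
    refine ⟨Fintype.equivOfCardEq ?_⟩
    have := congrArg (Multiset.count z) h
    rw [Multiset.count_map, Multiset.count_map] at this
    rw [Fintype.card_subtype, Fintype.card_subtype]
    simpa only [Finset.card_def, Finset.filter_val, eq_comm] using this
  exact ⟨Equiv.ofFiberEquiv fun z => (hcard z).some, fun a =>
    (Equiv.ofFiberEquiv_map (fun z => (hcard z).some) a).symm⟩

theorem exists_perm_comp {α β : Type*} [Finite β] {f g : α → β}
    (h : ∀ a b, f a = f b ↔ g a = g b) : ∃ τ : Equiv.Perm β, ∀ a, g a = τ (f a) := by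
  classical
  let e : {x // x ∈ Set.range f} ≃ {x // x ∈ Set.range g} :=
    Equiv.ofBijective (fun x => ⟨g x.2.choose, Set.mem_range_self _⟩) <| by
      constructor
      · intro x y hxy
        have := (h _ _).2 (Subtype.ext_iff.1 hxy)
        rw [x.2.choose_spec, y.2.choose_spec] at this
        exact Subtype.ext this
      · rintro ⟨_, a, rfl⟩
        refine ⟨⟨f a, a, rfl⟩, Subtype.ext ?_⟩
        exact (h _ _).1 (⟨a, rfl⟩ : ∃ b, f b = f a).choose_spec
  refine ⟨e.extendSubtype, fun a => ?_⟩
  rw [e.extendSubtype_apply_of_mem _ ⟨a, rfl⟩]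
  exact ((h _ _).1 (⟨a, rfl⟩ : ∃ b, f b = f a).choose_spec).symm

theorem famDim_le_smul [Finite I] (u : ι → I → K) {p : ι → K} (hp : ∀ a, p a ≠ 0)
    (S : Finset ι) : famDim u S ≤ famDim (fun a => p a • u a) S :=
  Submodule.finrank_mono <| famSpan_le fun a ha =>
    (Submodule.smul_mem_iff _ (hp a)).1 (mem_famSpan (fun a => p a • u a) ha)

theorem famDim_map {ι' : Type*} (u : ι → I → K) (e : ι' ↪ ι) (S : Finset ι') :
    famDim u (S.map e) = famDim (u ∘ e) S := by
  rw [famDim, famDim, famSpan, famSpan, Finset.coe_map, ← Set.image_comp]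

theorem tensor_smul (p : ι → K) (u : ι → I → K) (v : ι → I' → K) (a : ι) :
    tensor (fun a => p a • u a) v a = p a • tensor u v a := by
  ext
  simp [tensor, mul_assoc]

theorem famDim_eq_card_of_det_ne_zero [Finite I] [DecidableEq ι] {u : ι → I → K} {S : Finset ι}
    (X : ι → I) (h : (Matrix.of fun c c' : S => u c (X c')).det ≠ 0) : famDim u S = S.card := by
  have h1 := Matrix.linearIndependent_rows_of_det_ne_zero h
  have h2 : LinearIndependent K fun c : S => u c :=
    LinearIndependent.of_comp (LinearMap.funLeft K K fun c' : S => X c') h1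
  have h3 := finrank_span_eq_card h2
  rw [famDim, famSpan, Set.image_eq_range]
  exact h3.trans (Fintype.card_coe _)

/-- Kruskal's theorem on the uniqueness of a decomposition into product tensors. -/
theorem kruskal_unique {α : Type*} [Fintype α] [DecidableEq α] [Finite I₀] [Finite I₁] [Finite I₂]
    {p q : α → K} {u u' : α → I₀ → K} {v v' : α → I₁ → K} {w w' : α → I₂ → K}
    (hp : ∀ a, p a ≠ 0) (hu : ∀ a, u a ≠ 0) (hv : ∀ a, v a ≠ 0) (hw : ∀ a, w a ≠ 0)
    (hu' : ∀ a, u' a ≠ 0) (hv' : ∀ a, v' a ≠ 0) (hw' : ∀ a, w' a ≠ 0)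
    (hdim : ∀ S : Finset α, 2 ≤ S.card → 2 * S.card + 2 ≤ famDim u S + famDim v S + famDim w S)
    (hsum : ∑ a, p a • tensor u (tensor v w) a = ∑ a, q a • tensor u' (tensor v' w') a) :
    ∃ σ : Equiv.Perm α, ∀ a,
      p a • tensor u (tensor v w) a = q (σ a) • tensor u' (tensor v' w') (σ a) := by
  classical
  let U : α ⊕ α → I₀ → K := Sum.elim (fun a => p a • u a) (fun a => q a • u' a)
  let V : α ⊕ α → I₁ → K := Sum.elim v v'
  let W : α ⊕ α → I₂ → K := Sum.elim w w'
  have hl : ∀ a, tensor U (tensor V W) (Sum.inl a) = p a • tensor u (tensor v w) a :=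
    tensor_smul p u (tensor v w)
  have hr : ∀ a, tensor U (tensor V W) (Sum.inr a) = q a • tensor u' (tensor v' w') a :=
    tensor_smul q u' (tensor v' w')
  -- The second decomposition may have zero weights. Its zero terms are dropped, and equality of the
  -- multisets shows afterwards that there were none.
  set R : Finset α := Finset.univ.filter fun a => q a ≠ 0 with hR
  have h := sum_tensor_unique (u := U) (v := V) (w := W) _
    (Finset.univ.map Function.Embedding.inl) (R.map Function.Embedding.inr) le_rfl ?_ ?_ ?_ ?_ ?_
    ?_ ?_
  · rw [Finset.map_val, Finset.map_val, Multiset.map_map, Multiset.map_map] at h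
    have hRcard : Fintype.card α = R.card := by
      simpa only [Multiset.card_map, Finset.card_val, Finset.card_univ] using
        congrArg Multiset.card h
    have hRuniv : R = Finset.univ := Finset.card_eq_iff_eq_univ _ |>.1 hRcard.symm
    rw [hRuniv] at h
    obtain ⟨σ, hσ⟩ := exists_perm_of_map_univ_eq h
    exact ⟨σ, fun a => (hl a).symm.trans ((hσ a).trans (hr (σ a)))⟩
  · simp [Finset.disjoint_left]
  · rw [Finset.card_map, Finset.card_map]
    exact Finset.card_le_univ R
  · rintro (a | a) ha
    · exact smul_ne_zero (hp a) (hu a)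
    · have : q a ≠ 0 := by simpa [hR] using ha
      exact smul_ne_zero this (hu' a)
  · rintro (a | a) _
    exacts [hv a, hv' a]
  · rintro (a | a) _
    exacts [hw a, hw' a]
  · intro S' hS' h2
    obtain ⟨S, -, rfl⟩ := Finset.subset_map_iff.1 hS'
    rw [famDim_map, famDim_map, famDim_map]
    rw [Finset.card_map] at h2 ⊢
    have h3 := hdim S h2
    have h4 : famDim u S ≤ famDim (U ∘ Function.Embedding.inl) S := famDim_le_smul u hp S
    have h5 : V ∘ Function.Embedding.inl = v := rfl
    have h6 : W ∘ Function.Embedding.inl = w := rfl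
    rw [h5, h6]
    omega
  · rw [Finset.sum_map, Finset.sum_map]
    refine (Finset.sum_congr rfl fun a _ => hl a).trans (hsum.trans ?_)
    refine Eq.trans ?_ (Finset.sum_congr rfl fun a _ => (hr a).symm)
    rw [hR, Finset.sum_filter]
    refine Finset.sum_congr rfl fun a _ => ?_
    split_ifs with hq
    · rfl
    · rw [not_not.1 hq, zero_smul]

end Decomposition

end DLCM

namespace DLCM

variable {J C D : ℕ}

/-! ### Factors of a product over domains -/

/-- The response vector with given patterns on the domains of class `c`. -/
def glue {Q : Fin J → ℕ} {Δ : Fin J → Fin C → Fin D} {c : Fin C}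
    (r : ∀ d, Pattern Q (domainItems Δ c d)) (j : Fin J) : Fin (Q j) :=
  r (Δ j c) ⟨j, by simp [domainItems]⟩

theorem mem_domainItems {Δ : Fin J → Fin C → Fin D} {c : Fin C} {d : Fin D} {j : Fin J} :
    j ∈ domainItems Δ c d ↔ Δ j c = d := by
  simp [domainItems]

theorem restrict_glue {Q : Fin J → ℕ} {Δ : Fin J → Fin C → Fin D} {c : Fin C}
    (r : ∀ d, Pattern Q (domainItems Δ c d)) (d : Fin D) :
    (domainItems Δ c d).restrict (glue r) = r d := by
  funext ⟨j, hj⟩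
  obtain rfl := mem_domainItems.1 hj
  rfl

theorem exists_ne_zero_of_mem_stdSimplex {ι : Type*} [Fintype ι] {f : ι → ℝ}
    (hf : f ∈ stdSimplex ℝ ι) : ∃ i, f i ≠ 0 := by
  by_contra! h
  simpa [h] using hf.2

theorem exists_prod_ne_zero {Q : Fin J → ℕ} {Δ : Fin J → Fin C → Fin D} {c : Fin C}
    {f : ∀ d, Pattern Q (domainItems Δ c d) → ℝ}
    (hf : ∀ d, f d ∈ stdSimplex ℝ (Pattern Q (domainItems Δ c d))) :
    ∃ X : ∀ j, Fin (Q j), ∏ d, f d ((domainItems Δ c d).restrict X) ≠ 0 := by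
  choose r hr using fun d => exists_ne_zero_of_mem_stdSimplex (hf d)
  refine ⟨glue r, Finset.prod_ne_zero_iff.2 fun d _ => ?_⟩
  rw [restrict_glue]
  exact hr d

/-- Varying the pattern on one domain, with the others frozen where the product is nonzero, makes `f
d` and `g d` proportional; both sum to one, so they agree. -/
theorem factors_eq_of_prod_eq {Q : Fin J → ℕ} {Δ : Fin J → Fin C → Fin D} {c : Fin C}
    {f g : ∀ d, Pattern Q (domainItems Δ c d) → ℝ}
    (hf : ∀ d, f d ∈ stdSimplex ℝ (Pattern Q (domainItems Δ c d)))
    (hg : ∀ d, g d ∈ stdSimplex ℝ (Pattern Q (domainItems Δ c d))) {p q : ℝ} (hp : p ≠ 0)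
    (h : ∀ X : ∀ j, Fin (Q j), p * ∏ d, f d ((domainItems Δ c d).restrict X) =
      q * ∏ d, g d ((domainItems Δ c d).restrict X)) : p = q ∧ f = g := by
  obtain ⟨X₀, hX₀⟩ := exists_prod_ne_zero hf
  have hfg : f = g := by
    funext d r
    let Y : Pattern Q (domainItems Δ c d) → ∀ j, Fin (Q j) := fun s =>
      glue (Function.update (fun d' => (domainItems Δ c d').restrict X₀) d s)
    have hY : ∀ (k : ∀ d, Pattern Q (domainItems Δ c d) → ℝ) (s),
        ∏ d', k d' ((domainItems Δ c d').restrict (Y s)) =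
        k d s * ∏ d' ∈ Finset.univ.erase d, k d' ((domainItems Δ c d').restrict X₀) := by
      intro k s
      rw [← Finset.mul_prod_erase _ _ (Finset.mem_univ d), restrict_glue, Function.update_self]
      congr 1
      refine Finset.prod_congr rfl fun d' hd' => ?_
      rw [restrict_glue, Function.update_of_ne (Finset.ne_of_mem_erase hd')]
    have h1 : ∀ s,
        p * (f d s * ∏ d' ∈ Finset.univ.erase d, f d' ((domainItems Δ c d').restrict X₀)) =
        q * (g d s * ∏ d' ∈ Finset.univ.erase d, g d' ((domainItems Δ c d').restrict X₀)) :=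
      fun s => by rw [← hY f, ← hY g, h]
    set F := ∏ d' ∈ Finset.univ.erase d, f d' ((domainItems Δ c d').restrict X₀)
    set G := ∏ d' ∈ Finset.univ.erase d, g d' ((domainItems Δ c d').restrict X₀)
    have h2 : p * F = q * G := by
      have := Finset.sum_congr (rfl : Finset.univ = Finset.univ) fun s _ => h1 s
      simp_rw [← Finset.mul_sum, ← Finset.sum_mul] at this
      rwa [(hf d).2, (hg d).2, one_mul, one_mul] at this
    have hF : F ≠ 0 := by
      rw [← Finset.mul_prod_erase _ _ (Finset.mem_univ d)] at hX₀
      exact right_ne_zero_of_mul hX₀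
    refine mul_left_cancel₀ (mul_ne_zero hp hF) ?_
    calc p * F * f d r = p * (f d r * F) := by ring
      _ = q * (g d r * G) := h1 r
      _ = p * F * g d r := by rw [h2]; ring
  refine ⟨?_, hfg⟩
  subst hfg
  exact mul_right_cancel₀ hX₀ (h X₀)

theorem stdSimplex_transport {Q : Fin J → ℕ} {A B : Finset (Fin J)} (h : A = B)
    {v : Pattern Q B → ℝ} (hv : v ∈ stdSimplex ℝ (Pattern Q B)) :
    (fun r : Pattern Q A => v fun j => r ⟨j.1, h ▸ j.2⟩) ∈ stdSimplex ℝ (Pattern Q A) := by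
  subst h
  exact hv

/-! ### Conditional independence determines the domains -/

/-- No factor sees both items. The failure of this identity is the test that detects a shared
domain. -/
theorem classProb_exchange (Q : Fin J → ℕ) (Δ : Fin J → Fin C → Fin D) (θ : Theta Q Δ) {c : Fin C}
    {j₁ j₂ : Fin J} (hΔ : Δ j₁ c ≠ Δ j₂ c) (X : ∀ j, Fin (Q j)) (s : Fin (Q j₁))
    (t : Fin (Q j₂)) :
    classProb Q Δ θ c X * classProb Q Δ θ c (Function.update (Function.update X j₁ s) j₂ t) =
      classProb Q Δ θ c (Function.update X j₁ s) * classProb Q Δ θ c (Function.update X j₂ t) := by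
  have hj : j₁ ≠ j₂ := fun h => hΔ (by rw [h])
  have hres : ∀ (d : Fin D) (j : Fin J) (a : Fin (Q j)) (Y : ∀ j, Fin (Q j)), Δ j c ≠ d →
      (domainItems Δ c d).restrict (Function.update Y j a) = (domainItems Δ c d).restrict Y := by
    intro d j a Y hd
    funext ⟨i, hi⟩
    refine Function.update_of_ne ?_ _ _
    rintro rfl
    exact hd (mem_domainItems.1 hi)
  unfold classProb
  rw [← Finset.prod_mul_distrib, ← Finset.prod_mul_distrib]
  refine Finset.prod_congr rfl fun d _ => ?_
  by_cases hd : Δ j₁ c = d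
  · have hd2 : Δ j₂ c ≠ d := fun h => hΔ (hd.trans h.symm)
    rw [hres d j₂ t _ hd2, hres d j₂ t _ hd2, mul_comm]
  · rw [hres d j₁ s _ hd, Function.update_comm hj, hres d j₁ s _ hd]

/-- The number of item pairs that share a domain cannot drop from `c` to `σ c`, while its total over
the classes is invariant under `σ`; hence no class gains a pair. -/
theorem domain_eq_iff_of_refines {Δ : Fin J → Fin C → Fin D} {σ : Equiv.Perm (Fin C)}
    (h : ∀ c j₁ j₂, Δ j₁ c = Δ j₂ c → Δ j₁ (σ c) = Δ j₂ (σ c)) (c : Fin C) (j₁ j₂ : Fin J) :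
    Δ j₁ c = Δ j₂ c ↔ Δ j₁ (σ c) = Δ j₂ (σ c) := by
  let N : Fin C → Finset (Fin J × Fin J) := fun c =>
    Finset.univ.filter fun p => Δ p.1 c = Δ p.2 c
  have hsub : ∀ c, N c ⊆ N (σ c) := fun c p hp => by
    simp only [N, Finset.mem_filter, Finset.mem_univ, true_and] at hp ⊢
    exact h c _ _ hp
  have hsum : ∑ c, (N c).card = ∑ c, (N (σ c)).card := (Equiv.sum_comp σ fun c => (N c).card).symm
  have hcard := (Finset.sum_eq_sum_iff_of_le fun c _ => Finset.card_le_card (hsub c)).1 hsum c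
    (Finset.mem_univ c)
  have heq := Finset.eq_of_subset_of_card_le (hsub c) hcard.ge
  simpa [N] using Finset.ext_iff.1 heq (j₁, j₂)

theorem eqUpToRelabeling_of_proportional {Q : Fin J → ℕ} {Δ : Fin J → Fin C → Fin D}
    {ω ω' : Param Q Δ} (hω : ω ∈ paramSpace Q Δ) (hω' : ω' ∈ paramSpace Q Δ)
    (hπ : ∀ c, ω.1 c ≠ 0)
    (hdep : ∀ c j₁ j₂, j₁ ≠ j₂ → Δ j₁ c = Δ j₂ c → ∃ X : ∀ j, Fin (Q j), ∃ s t,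
      classProb Q Δ ω.2 c X *
          classProb Q Δ ω.2 c (Function.update (Function.update X j₁ s) j₂ t) ≠
        classProb Q Δ ω.2 c (Function.update X j₁ s) *
          classProb Q Δ ω.2 c (Function.update X j₂ t))
    {σ : Equiv.Perm (Fin C)}
    (hσ : ∀ c X, ω.1 c * classProb Q Δ ω.2 c X = ω'.1 (σ c) * classProb Q Δ ω'.2 (σ c) X) :
    EqUpToRelabeling Q Δ ω ω' := by
  have href : ∀ c j₁ j₂, Δ j₁ c = Δ j₂ c → Δ j₁ (σ c) = Δ j₂ (σ c) := by
    intro c j₁ j₂ h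
    by_cases hj : j₁ = j₂
    · rw [hj]
    by_contra hne
    obtain ⟨X, s, t, hX⟩ := hdep c j₁ j₂ hj h
    refine hX (mul_left_cancel₀ (mul_ne_zero (hπ c) (hπ c)) ?_)
    rw [mul_mul_mul_comm, hσ, hσ, mul_mul_mul_comm, classProb_exchange Q Δ ω'.2 hne X s t,
      mul_mul_mul_comm, ← hσ, ← hσ, mul_mul_mul_comm]
  choose τ hτ using fun c => exists_perm_comp (f := fun j => Δ j c) (g := fun j => Δ j (σ c))
    (domain_eq_iff_of_refines href c)
  have hdom : ∀ c d, domainItems Δ c d = domainItems Δ (σ c) (τ c d) := by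
    intro c d
    ext j
    rw [mem_domainItems, mem_domainItems, hτ c j, (τ c).injective.eq_iff]
  have hkey : ∀ c, ω.1 c = ω'.1 (σ c) ∧
      ω.2 c = fun d r => ω'.2 (σ c) (τ c d) fun j => r ⟨j.1, (hdom c d).symm ▸ j.2⟩ := by
    intro c
    refine factors_eq_of_prod_eq (hω.2 c)
      (fun d => stdSimplex_transport (hdom c d) (hω'.2 (σ c) (τ c d))) (hπ c) fun X => ?_
    refine (hσ c X).trans ?_
    congr 1
    exact (Equiv.prod_comp (τ c) fun d =>
      ω'.2 (σ c) d ((domainItems Δ (σ c) d).restrict X)).symm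
  refine ⟨σ, τ, fun j c => hτ c j, fun c => (hkey c).1.symm, fun c d X => ?_⟩
  rw [(hkey c).2]
  rfl

end DLCM

namespace DLCM

open MeasureTheory
open scoped ContDiff

variable {J C D : ℕ}

/-! ### Blocks of pooled domains -/

/-- The product of the marginals of the parts in `S`, given class `c`. -/
noncomputable def blockProb (Q : Fin J → ℕ) (Δ : Fin J → Fin C → Fin D) (θ : Theta Q Δ)
    (S : Finset (Finset (Fin J))) (c : Fin C) (X : ∀ j, Fin (Q j)) : ℝ :=
  ∏ P ∈ S, classMarginal Q Δ θ c P (P.restrict X)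

theorem blockProb_congr (Q : Fin J → ℕ) (Δ : Fin J → Fin C → Fin D) (θ : Theta Q Δ)
    {S : Finset (Finset (Fin J))} (c : Fin C) {X Y : ∀ j, Fin (Q j)}
    (h : ∀ j ∈ S.biUnion id, X j = Y j) : blockProb Q Δ θ S c X = blockProb Q Δ θ S c Y := by
  refine Finset.prod_congr rfl fun P hP => ?_
  congr 1
  funext ⟨j, hj⟩
  exact h j (Finset.mem_biUnion.2 ⟨P, hP, hj⟩)

theorem classProb_eq_mul_blockProb {Q : Fin J → ℕ} {Δ : Fin J → Fin C → Fin D}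
    {W : Finpartition (Finset.univ : Finset (Fin J))} (hW : IsCondIndepPartition Q Δ W)
    {S₀ S₁ S₂ : Finset (Finset (Fin J))} (h01 : Disjoint S₀ S₁) (h02 : Disjoint S₀ S₂)
    (h12 : Disjoint S₁ S₂) (hS : S₀ ∪ S₁ ∪ S₂ = W.parts) {θ : Theta Q Δ} (hθ : IsTheta Q Δ θ)
    (c : Fin C) (X : ∀ j, Fin (Q j)) :
    classProb Q Δ θ c X =
      blockProb Q Δ θ S₀ c X * (blockProb Q Δ θ S₁ c X * blockProb Q Δ θ S₂ c X) := by
  rw [hW θ hθ c X, ← hS, Finset.prod_union (Finset.disjoint_union_left.2 ⟨h02, h12⟩),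
    Finset.prod_union h01, mul_assoc]
  rfl

theorem disjoint_biUnion_parts {W : Finpartition (Finset.univ : Finset (Fin J))}
    {S T : Finset (Finset (Fin J))} (hS : S ⊆ W.parts) (hT : T ⊆ W.parts) (h : Disjoint S T) :
    Disjoint (S.biUnion id) (T.biUnion id) := by
  rw [Finset.disjoint_biUnion_left]
  intro P hP
  rw [Finset.disjoint_biUnion_right]
  intro P' hP'
  exact W.disjoint (hS hP) (hT hP') fun e => Finset.disjoint_left.1 h hP (e ▸ hP')

theorem prob_merge {Q : Fin J → ℕ} {Δ : Fin J → Fin C → Fin D}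
    {W : Finpartition (Finset.univ : Finset (Fin J))} (hW : IsCondIndepPartition Q Δ W)
    {S₀ S₁ S₂ : Finset (Finset (Fin J))} (h01 : Disjoint S₀ S₁) (h02 : Disjoint S₀ S₂)
    (h12 : Disjoint S₁ S₂) (hS : S₀ ∪ S₁ ∪ S₂ = W.parts) (X₀ X₁ X₂ : ∀ j, Fin (Q j)) :
    ∃ X : ∀ j, Fin (Q j), ∀ υ ∈ paramSpace Q Δ, prob Q Δ υ X =
      ∑ c, υ.1 c * (blockProb Q Δ υ.2 S₀ c X₀ *
        (blockProb Q Δ υ.2 S₁ c X₁ * blockProb Q Δ υ.2 S₂ c X₂)) := by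
  have hs0 : S₀ ⊆ W.parts := hS ▸ Finset.subset_union_left.trans Finset.subset_union_left
  have hs1 : S₁ ⊆ W.parts := hS ▸ Finset.subset_union_right.trans Finset.subset_union_left
  have hs2 : S₂ ⊆ W.parts := hS ▸ Finset.subset_union_right
  have d01 := Finset.disjoint_left.1 (disjoint_biUnion_parts hs0 hs1 h01)
  have d02 := Finset.disjoint_left.1 (disjoint_biUnion_parts hs0 hs2 h02)
  have d12 := Finset.disjoint_left.1 (disjoint_biUnion_parts hs1 hs2 h12)
  let X : ∀ j, Fin (Q j) := fun j =>
    if j ∈ S₀.biUnion id then X₀ j else if j ∈ S₁.biUnion id then X₁ j else X₂ j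
  have e₀ : ∀ j ∈ S₀.biUnion id, X j = X₀ j := fun j hj => if_pos hj
  have e₁ : ∀ j ∈ S₁.biUnion id, X j = X₁ j := fun j hj =>
    (if_neg fun h => d01 h hj).trans (if_pos hj)
  have e₂ : ∀ j ∈ S₂.biUnion id, X j = X₂ j := fun j hj =>
    (if_neg fun h => d02 h hj).trans (if_neg fun h => d12 h hj)
  refine ⟨X, fun υ hυ => Finset.sum_congr rfl fun c _ => ?_⟩
  rw [classProb_eq_mul_blockProb hW h01 h02 h12 hS hυ.2, blockProb_congr Q Δ υ.2 c e₀,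
    blockProb_congr Q Δ υ.2 c e₁, blockProb_congr Q Δ υ.2 c e₂]

theorem min_le_famDim {ι I K : Type*} [Field K] [Finite I] {u : ι → I → K} {k : ℕ}
    (h : ∀ S : Finset ι, S.card ≤ k → famDim u S = S.card) (S : Finset ι) :
    min k S.card ≤ famDim u S := by
  obtain ⟨T, hTS, hT⟩ := Finset.exists_subset_card_eq (min_le_right k S.card)
  rw [← hT, ← h T (hT.trans_le (min_le_left _ _))]
  exact famDim_mono u hTS

theorem eqUpToRelabeling_of_generic {Q : Fin J → ℕ} {Δ : Fin J → Fin C → Fin D}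
    {W : Finpartition (Finset.univ : Finset (Fin J))} (hW : IsCondIndepPartition Q Δ W)
    {S₀ S₁ S₂ : Finset (Finset (Fin J))} (h01 : Disjoint S₀ S₁) (h02 : Disjoint S₀ S₂)
    (h12 : Disjoint S₁ S₂) (hS : S₀ ∪ S₁ ∪ S₂ = W.parts)
    (hκ : 2 * C + 2 ≤ min (kappa Q S₀) C + min (kappa Q S₁) C + min (kappa Q S₂) C)
    {υ υ' : Param Q Δ} (hυ : υ ∈ paramSpace Q Δ) (hυ' : υ' ∈ paramSpace Q Δ)
    (hπ : ∀ c, υ.1 c ≠ 0)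
    (hrank : ∀ S ∈ ({S₀, S₁, S₂} : Finset (Finset (Finset (Fin J)))), ∀ T : Finset (Fin C),
      T.card ≤ kappa Q S → famDim (blockProb Q Δ υ.2 S) T = T.card)
    (hdep : ∀ c j₁ j₂, j₁ ≠ j₂ → Δ j₁ c = Δ j₂ c → ∃ X : ∀ j, Fin (Q j), ∃ s t,
      classProb Q Δ υ.2 c X *
          classProb Q Δ υ.2 c (Function.update (Function.update X j₁ s) j₂ t) ≠
        classProb Q Δ υ.2 c (Function.update X j₁ s) *
          classProb Q Δ υ.2 c (Function.update X j₂ t))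
    (hprob : ∀ X, prob Q Δ υ' X = prob Q Δ υ X) : EqUpToRelabeling Q Δ υ υ' := by
  have hne : ∀ ψ ∈ paramSpace Q Δ, ∀ c, blockProb Q Δ ψ.2 S₀ c ≠ 0 ∧
      blockProb Q Δ ψ.2 S₁ c ≠ 0 ∧ blockProb Q Δ ψ.2 S₂ c ≠ 0 := by
    intro ψ hψ c
    obtain ⟨X, hX⟩ := exists_prod_ne_zero (hψ.2 c)
    have h := classProb_eq_mul_blockProb hW h01 h02 h12 hS hψ.2 c X
    unfold classProb at h
    rw [h] at hX
    refine ⟨fun h0 => hX ?_, fun h0 => hX ?_, fun h0 => hX ?_⟩ <;> simp [h0]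
  have hr₀ := min_le_famDim (hrank S₀ (by simp))
  have hr₁ := min_le_famDim (hrank S₁ (by simp))
  have hr₂ := min_le_famDim (hrank S₂ (by simp))
  obtain ⟨σ, hσ⟩ := kruskal_unique (q := υ'.1) (u' := blockProb Q Δ υ'.2 S₀)
    (v' := blockProb Q Δ υ'.2 S₁) (w' := blockProb Q Δ υ'.2 S₂) hπ
    (fun c => (hne υ hυ c).1) (fun c => (hne υ hυ c).2.1) (fun c => (hne υ hυ c).2.2)
    (fun c => (hne υ' hυ' c).1) (fun c => (hne υ' hυ' c).2.1) (fun c => (hne υ' hυ' c).2.2)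
    -- Going from `C` down to `T.card` shrinks each positive shortfall `C - min κ C` by `C -
    -- T.card`, or to zero. The shortfalls total at most `C - 2`, so they now total at most `T.card
    -- - 2`; if all vanish, `hT` suffices.
    (fun T hT => by
      have h0 := hr₀ T
      have h1 := hr₁ T
      have h2 := hr₂ T
      have h3 := Finset.card_le_univ T
      rw [Fintype.card_fin] at h3
      omega)
    (by
      funext ⟨X₀, X₁, X₂⟩
      obtain ⟨X, hX⟩ := prob_merge hW h01 h02 h12 hS X₀ X₁ X₂
      have := hprob X
      rw [hX υ hυ, hX υ' hυ'] at this
      simpa [tensor, Finset.sum_apply] using this.symm)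
  refine eqUpToRelabeling_of_proportional hυ hυ' hπ hdep (σ := σ) fun c X => ?_
  rw [classProb_eq_mul_blockProb hW h01 h02 h12 hS hυ.2,
    classProb_eq_mul_blockProb hW h01 h02 h12 hS hυ'.2]
  exact congrFun (hσ c) (X, X, X)

/-! ### Generic parameters -/

/-- The parameter that concentrates class `c` on the response vector `X c`. -/
def diracTheta (Q : Fin J → ℕ) (Δ : Fin J → Fin C → Fin D) (X : Fin C → ∀ j, Fin (Q j)) :
    Theta Q Δ :=
  fun c d r => if (domainItems Δ c d).restrict (X c) = r then 1 else 0

theorem isTheta_diracTheta (Q : Fin J → ℕ) (Δ : Fin J → Fin C → Fin D)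
    (X : Fin C → ∀ j, Fin (Q j)) : IsTheta Q Δ (diracTheta Q Δ X) :=
  fun c d => ite_eq_mem_stdSimplex ℝ ((domainItems Δ c d).restrict (X c))

theorem classProb_diracTheta (Q : Fin J → ℕ) (Δ : Fin J → Fin C → Fin D)
    (X : Fin C → ∀ j, Fin (Q j)) (c : Fin C) (Y : ∀ j, Fin (Q j)) :
    classProb Q Δ (diracTheta Q Δ X) c Y = if X c = Y then 1 else 0 := by
  unfold classProb diracTheta
  rw [Finset.prod_ite_zero]
  simp only [Finset.prod_const_one]
  refine if_congr ⟨fun h => ?_, fun h => by simp [h]⟩ rfl rfl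
  funext j
  exact congrFun (h (Δ j c) (Finset.mem_univ _)) ⟨j, mem_domainItems.2 rfl⟩

theorem classMarginal_diracTheta (Q : Fin J → ℕ) (Δ : Fin J → Fin C → Fin D)
    (X : Fin C → ∀ j, Fin (Q j)) (c : Fin C) (P : Finset (Fin J)) (r : Pattern Q P) :
    classMarginal Q Δ (diracTheta Q Δ X) c P r = if P.restrict (X c) = r then 1 else 0 := by
  unfold classMarginal
  simp_rw [classProb_diracTheta, Finset.sum_filter]
  rw [Finset.sum_eq_single (X c)]
  · simp
  · intro Y _ hY
    simp [hY.symm]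
  · simp

theorem blockProb_diracTheta (Q : Fin J → ℕ) (Δ : Fin J → Fin C → Fin D)
    (X : Fin C → ∀ j, Fin (Q j)) (S : Finset (Finset (Fin J))) (c : Fin C)
    (Y : ∀ j, Fin (Q j)) : blockProb Q Δ (diracTheta Q Δ X) S c Y =
      if (S.biUnion id).restrict (X c) = (S.biUnion id).restrict Y then 1 else 0 := by
  unfold blockProb
  simp_rw [classMarginal_diracTheta]
  rw [Finset.prod_ite_zero]
  simp only [Finset.prod_const_one]
  refine if_congr ⟨fun h => ?_, fun h P hP => ?_⟩ rfl rfl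
  · funext ⟨j, hj⟩
    obtain ⟨P, hP, hjP⟩ := Finset.mem_biUnion.1 hj
    exact congrFun (h P hP) ⟨j, hjP⟩
  · funext ⟨j, hj⟩
    exact congrFun h ⟨j, Finset.mem_biUnion.2 ⟨P, hP, hj⟩⟩

theorem contDiff_classProb (Q : Fin J → ℕ) (Δ : Fin J → Fin C → Fin D) (c : Fin C)
    (X : ∀ j, Fin (Q j)) : ContDiff ℝ ω fun υ : Param Q Δ => classProb Q Δ υ.2 c X :=
  contDiff_prod fun d _ => contDiff_pi.1 (contDiff_pi.1 (contDiff_pi.1 contDiff_snd c) d) _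

theorem contDiff_blockProb (Q : Fin J → ℕ) (Δ : Fin J → Fin C → Fin D)
    (S : Finset (Finset (Fin J))) (c : Fin C) (X : ∀ j, Fin (Q j)) :
    ContDiff ℝ ω fun υ : Param Q Δ => blockProb Q Δ υ.2 S c X :=
  contDiff_prod fun _ _ => ContDiff.sum fun Y _ => contDiff_classProb Q Δ c Y

variable (Q : Fin J → ℕ) [∀ j, NeZero (Q j)] [NeZero C] (Δ : Fin J → Fin C → Fin D)

theorem ae_ne_zero {f : Param Q Δ → ℝ} (hf : ContDiff ℝ ω f) {υ : Param Q Δ}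
    (hυ : υ ∈ paramSpace Q Δ) (h₀ : f υ ≠ 0) : ∀ᵐ x ∂paramMeasure Q Δ, f x ≠ 0 := by
  rw [ae_iff]
  simpa using paramMeasure_zeroSet Q Δ hf hυ h₀

theorem ae_class_weight_ne_zero (c : Fin C) : ∀ᵐ υ ∂paramMeasure Q Δ, υ.1 c ≠ 0 :=
  ae_ne_zero Q Δ (f := fun υ => υ.1 c) (contDiff_pi.1 contDiff_fst c)
    (υ := (fun i => if c = i then 1 else 0, diracTheta Q Δ fun _ _ => 0))
    ⟨ite_eq_mem_stdSimplex ℝ c, isTheta_diracTheta Q Δ _⟩ (by simp)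

theorem ae_famDim_blockProb (S : Finset (Finset (Fin J))) (T : Finset (Fin C))
    (hT : T.card ≤ kappa Q S) :
    ∀ᵐ υ ∂paramMeasure Q Δ, famDim (blockProb Q Δ υ.2 S) T = T.card := by
  have hcard : Fintype.card T ≤ Fintype.card (Pattern Q (S.biUnion id)) := by
    rw [Fintype.card_coe, Fintype.card_pi]
    simp only [Fintype.card_fin]
    rw [Finset.prod_coe_sort (S.biUnion id) Q]
    exact hT
  obtain ⟨e⟩ := Function.Embedding.nonempty_of_card_le hcard
  -- Distinct classes of `T` get distinct patterns on the block; at the corresponding point masses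
  -- the matrix is the identity.
  let X : Fin C → ∀ j, Fin (Q j) := fun c j =>
    if h : c ∈ T ∧ j ∈ S.biUnion id then e ⟨c, h.1⟩ ⟨j, h.2⟩ else 0
  have hX : ∀ c : T, (S.biUnion id).restrict (X c) = e c := fun c => by
    funext ⟨j, hj⟩
    exact dif_pos (⟨c.2, hj⟩ : (c : Fin C) ∈ T ∧ j ∈ S.biUnion id)
  have hdet : ContDiff ℝ ω fun υ : Param Q Δ =>
      (Matrix.of fun c c' : T => blockProb Q Δ υ.2 S c (X c')).det := by
    simp_rw [Matrix.det_apply]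
    exact ContDiff.sum fun g _ => (contDiff_prod fun c _ =>
      contDiff_blockProb Q Δ S _ _).const_smul _
  have hae := ae_ne_zero Q Δ hdet
    (υ := (fun i => if (0 : Fin C) = i then 1 else 0, diracTheta Q Δ X))
    ⟨ite_eq_mem_stdSimplex ℝ 0, isTheta_diracTheta Q Δ _⟩ (by
      have : (Matrix.of fun c c' : T => blockProb Q Δ (diracTheta Q Δ X) S c (X c')) = 1 := by
        ext c c'
        rw [Matrix.of_apply, blockProb_diracTheta, hX, hX, Matrix.one_apply]
        simp only [e.injective.eq_iff]
      rw [this, Matrix.det_one]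
      exact one_ne_zero)
  filter_upwards [hae] with υ hυ
  exact famDim_eq_card_of_det_ne_zero X hυ

theorem ae_dependent (c : Fin C) {j₁ j₂ : Fin J} (hj : j₁ ≠ j₂) (hΔ : Δ j₁ c = Δ j₂ c)
    (X : ∀ j, Fin (Q j)) {s : Fin (Q j₁)} {t : Fin (Q j₂)} (hs : s ≠ X j₁) (ht : t ≠ X j₂) :
    ∀ᵐ υ ∂paramMeasure Q Δ, classProb Q Δ υ.2 c X *
        classProb Q Δ υ.2 c (Function.update (Function.update X j₁ s) j₂ t) ≠
      classProb Q Δ υ.2 c (Function.update X j₁ s) *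
        classProb Q Δ υ.2 c (Function.update X j₂ t) := by
  set Y := Function.update (Function.update X j₁ s) j₂ t with hY
  -- Within each domain only the patterns of `X` and `Y` have mass. Changing `j₁` alone gives
  -- neither pattern on the shared domain, so the right-hand product vanishes and the left-hand one
  -- does not.
  let θ : Theta Q Δ := fun c d r => 2⁻¹ * diracTheta Q Δ (fun _ => X) c d r +
    2⁻¹ * diracTheta Q Δ (fun _ => Y) c d r
  have hθ : IsTheta Q Δ θ := fun c d =>
    convex_stdSimplex ℝ _ (isTheta_diracTheta Q Δ (fun _ => X) c d)
      (isTheta_diracTheta Q Δ (fun _ => Y) c d) (by norm_num) (by norm_num) (by norm_num)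
  have hpos : ∀ c d r, 0 ≤ diracTheta Q Δ (fun _ => X) c d r ∧
      0 ≤ diracTheta Q Δ (fun _ => Y) c d r := fun c d r =>
    ⟨(isTheta_diracTheta Q Δ (fun _ => X) c d).1 r, (isTheta_diracTheta Q Δ (fun _ => Y) c d).1 r⟩
  have hX0 : classProb Q Δ θ c X ≠ 0 := Finset.prod_ne_zero_iff.2 fun d _ => by
    have h1 : diracTheta Q Δ (fun _ => X) c d ((domainItems Δ c d).restrict X) = 1 := if_pos rfl
    have h2 := (hpos c d ((domainItems Δ c d).restrict X)).2
    refine ne_of_gt ?_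
    simp only [θ, h1]
    linarith
  have hY0 : classProb Q Δ θ c Y ≠ 0 := Finset.prod_ne_zero_iff.2 fun d _ => by
    have h1 : diracTheta Q Δ (fun _ => Y) c d ((domainItems Δ c d).restrict Y) = 1 := if_pos rfl
    have h2 := (hpos c d ((domainItems Δ c d).restrict Y)).1
    refine ne_of_gt ?_
    simp only [θ, h1]
    linarith
  have hX' : classProb Q Δ θ c (Function.update X j₁ s) = 0 := by
    refine Finset.prod_eq_zero (Finset.mem_univ (Δ j₁ c)) ?_
    have h1 : (domainItems Δ c (Δ j₁ c)).restrict X ≠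
        (domainItems Δ c (Δ j₁ c)).restrict (Function.update X j₁ s) := fun h => hs <| by
      simpa using (congrFun h ⟨j₁, mem_domainItems.2 rfl⟩).symm
    have h2 : (domainItems Δ c (Δ j₁ c)).restrict Y ≠
        (domainItems Δ c (Δ j₁ c)).restrict (Function.update X j₁ s) := fun h => ht <| by
      have := congrFun h ⟨j₂, mem_domainItems.2 hΔ.symm⟩
      simpa [hY, Function.update_of_ne hj.symm] using this
    simp [θ, diracTheta, h1, h2]
  have hae := ae_ne_zero Q Δ
    (((contDiff_classProb Q Δ c X).mul (contDiff_classProb Q Δ c Y)).sub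
      ((contDiff_classProb Q Δ c (Function.update X j₁ s)).mul
        (contDiff_classProb Q Δ c (Function.update X j₂ t))))
    (υ := (fun i => if c = i then 1 else 0, θ)) ⟨ite_eq_mem_stdSimplex ℝ c, hθ⟩ (by
      simpa [hX'] using ⟨hX0, hY0⟩)
  filter_upwards [hae] with υ hυ
  exact sub_ne_zero.1 hυ

end DLCM

/-! ### Assembly of the generic conditions -/

theorem mainTheorem2 {J C D : ℕ} [NeZero C] (Q : Fin J → ℕ) [∀ j, NeZero (Q j)]
    (hQ : ∀ j, 2 ≤ Q j) (Δ : Fin J → Fin C → Fin D)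
    (W : Finpartition (Finset.univ : Finset (Fin J))) (hW : DLCM.IsPooled Q Δ W)
    (S₀ S₁ S₂ : Finset (Finset (Fin J)))
    (h01 : Disjoint S₀ S₁) (h02 : Disjoint S₀ S₂) (h12 : Disjoint S₁ S₂)
    (hS : S₀ ∪ S₁ ∪ S₂ = W.parts)
    (hκ : 2 * C + 2 ≤
      min (DLCM.kappa Q S₀) C + min (DLCM.kappa Q S₁) C + min (DLCM.kappa Q S₂) C) :
    DLCM.GenericallyIdentifiable Q Δ := by
  have hweight := MeasureTheory.ae_all_iff.2 (DLCM.ae_class_weight_ne_zero Q Δ)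
  have hrank : ∀ S : Finset (Finset (Fin J)), ∀ᵐ υ ∂DLCM.paramMeasure Q Δ,
      ∀ T : Finset (Fin C), T.card ≤ DLCM.kappa Q S →
        DLCM.famDim (DLCM.blockProb Q Δ υ.2 S) T = T.card := fun S => by
    refine MeasureTheory.ae_all_iff.2 fun T => ?_
    by_cases hT : T.card ≤ DLCM.kappa Q S
    · filter_upwards [DLCM.ae_famDim_blockProb Q Δ S T hT] with υ hυ _ using hυ
    · exact Filter.Eventually.of_forall fun υ h => absurd h hT
  have hdep : ∀ᵐ υ ∂DLCM.paramMeasure Q Δ, ∀ c j₁ j₂, j₁ ≠ j₂ → Δ j₁ c = Δ j₂ c →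
      ∃ X : ∀ j, Fin (Q j), ∃ s t, DLCM.classProb Q Δ υ.2 c X *
          DLCM.classProb Q Δ υ.2 c (Function.update (Function.update X j₁ s) j₂ t) ≠
        DLCM.classProb Q Δ υ.2 c (Function.update X j₁ s) *
          DLCM.classProb Q Δ υ.2 c (Function.update X j₂ t) := by
    simp only [MeasureTheory.ae_all_iff]
    intro c j₁ j₂ hj hΔ
    -- Two levels per item leave room to change a response; an item with a single level could never
    -- reveal its domain.
    have hlevel : ∀ j, (⟨1, hQ j⟩ : Fin (Q j)) ≠ 0 := fun j h => by simpa using Fin.ext_iff.1 h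
    filter_upwards [DLCM.ae_dependent Q Δ c hj hΔ (fun _ => 0) (hlevel j₁) (hlevel j₂)] with υ hυ
    exact ⟨_, _, _, hυ⟩
  have hmain : ∀ᵐ υ ∂DLCM.paramMeasure Q Δ,
      ¬ (υ ∈ DLCM.paramSpace Q Δ ∧ ¬ DLCM.HasUniqueDistribution Q Δ υ) := by
    filter_upwards [hweight, hrank S₀, hrank S₁, hrank S₂, hdep] with υ h₁ hr₀ hr₁ hr₂ h₃
    rintro ⟨hυ, hn⟩
    refine hn fun υ' hυ' hprob => ?_
    refine DLCM.eqUpToRelabeling_of_generic hW.1 h01 h02 h12 hS hκ hυ hυ' h₁ ?_ h₃ hprob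
    intro S hS'
    simp only [Finset.mem_insert, Finset.mem_singleton] at hS'
    rcases hS' with rfl | rfl | rfl
    exacts [hr₀, hr₁, hr₂]
  simpa only [DLCM.GenericallyIdentifiable, MeasureTheory.ae_iff, not_not] using hmain
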